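/- Let $F(a,b;c;\zeta)$ denote the Gauss hypergeometric function. For an integer $d\ge 1$ let $\omega_d$ denote the area of the $d$-dimensional unit sphere $S^{d}\subset\mathbb R^{d+1}$, let $dS_y$ denote surface measure on the unit sphere $S^{n-1}\subset\mathbb R^n$, and let $B_1^n(0)=\{y\in\mathbb R^n : |y|\le 1\}$ with Lebesgue measure $dV_y$. For all real $t\ge b\ge 0$ the following hold. (i) $$t-b=\int_{-(e^{-b}-e^{-t})}^{e^{-b}-e^{-t}}\big((e^{-t}+e^{-b})^2-z^2\big)^{-\frac12}F\Big(\tfrac12,\tfrac12;1;\frac{(e^{-b}-e^{-t})^2-z^2}{(e^{-b}+e^{-t})^2-z^2}\Big)\,dz .$$ (ii) If $n=2m+1$ with an integer $m\ge 1$, then with $c_0^{(n)}=1\cdot3\cdots(n-2)$, $$t-b=2\int_0^{e^{-b}-e^{-t}}\left(\frac{\partial}{\partial r}\Big(\frac1r\frac{\partial}{\partial r}\Big)^{\frac{n-3}2}\frac{r^{n-2}}{\omega_{n-1}c_0^{(n)}}\int_{S^{n-1}}dS_y\right)_{r=r_1}\big((e^{-t}+e^{-b})^2-r_1^2\big)^{-\frac12}F\Big(\tfrac12,\tfrac12;1;\frac{(e^{-b}-e^{-t})^2-r_1^2}{(e^{-b}+e^{-t})^2-r_1^2}\Big)\,dr_1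 .$$ (iii) If $n=2m$ with an integer $m\ge 1$, then with $c_0^{(n)}=1\cdot3\cdots(n-1)$, $$t-b=2\int_0^{e^{-b}-e^{-t}}\left(\frac{\partial}{\partial r}\Big(\frac1r\frac{\partial}{\partial r}\Big)^{\frac{n-2}2}\frac{2r^{n-1}}{\omega_{n}c_0^{(n)}}\int_{B_1^n(0)}\frac{1}{\sqrt{1-|y|^2}}\,dV_y\right)_{r=r_1}\big((e^{-t}+e^{-b})^2-r_1^2\big)^{-\frac12}F\Big(\tfrac12,\tfrac12;1;\frac{(e^{-b}-e^{-t})^2-r_1^2}{(e^{-b}+e^{-t})^2-r_1^2}\Big)\,dr_1 .$$ -/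

import Mathlib

open scoped Nat
open MeasureTheory

/-- The kernel
`((e^{-t} + e^{-b})² - z²)^{-1/2} F(1/2, 1/2; 1; ((e^{-b} - e^{-t})² - z²) / ((e^{-b} + e^{-t})² - z²))`,
with `F` the Gauss hypergeometric function. For `|z| ≤ e^{-b} - e^{-t}` the base of the power is
positive and the argument of `F` lies in `[0, 1)`, inside the disc of convergence of its series. -/
noncomputable def deSitterKernel (t b z : ℝ) : ℝ :=
  ((Real.exp (-t) + Real.exp (-b)) ^ 2 - z ^ 2) ^ (-(1 / 2) : ℝ) *
    ordinaryHypergeometric (1 / 2 : ℝ) (1 / 2 : ℝ) (1 : ℝ)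
      (((Real.exp (-b) - Real.exp (-t)) ^ 2 - z ^ 2) /
        ((Real.exp (-b) + Real.exp (-t)) ^ 2 - z ^ 2))

/-- The surface measure `dS` of the unit sphere `S^{d-1}` of `ℝ^d`. -/
noncomputable def surfaceMeasure (d : ℕ) :
    Measure (Metric.sphere (0 : EuclideanSpace ℝ (Fin d)) 1) :=
  (volume : Measure (EuclideanSpace ℝ (Fin d))).toSphere

/-- `sphereArea d` is the area of the `d`-dimensional unit sphere
`S^d = {y ∈ ℝ^{d+1} : |y| = 1}`, the number usually written `ω_d`. -/
noncomputable def sphereArea (d : ℕ) : ℝ :=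
  (surfaceMeasure (d + 1)).real Set.univ

/-- The differential operator `(1/r) ∂/∂r`. -/
noncomputable def invRadialDeriv (g : ℝ → ℝ) : ℝ → ℝ :=
  fun r => (1 / r) * deriv g r

/-!
Write `A = e^{-b} - e^{-t}` and `B = e^{-b} + e^{-t}`, so that `0 ≤ A < B`, and `K` for the kernel.

*The integral of the kernel.* The Wallis integrals `∫₀^π cos^{2k}` and the binomial series turn the
hypergeometric series into the elliptic integral
`F(1/2, 1/2; 1; x) = π⁻¹ ∫₀^π (1 - x cos² θ)^{-1/2} dθ` for `|x| < 1`
(`ordinaryHypergeometric_half_half_one`). With `z = -A cos α` the two factors of `K` combine to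
`K(z) = π⁻¹ ∫₀^π (B² - A² + A² (sin α sin θ)²)^{-1/2} dθ` (`deSitterKernel_neg_mul_cos`), whence
`∫_{-A}^A K = (A / π) ∫₀^π ∫₀^π f((sin α sin θ)²) sin α dθ dα` for `f(u) = (B² - A² + A² u)^{-1/2}`.
In spherical coordinates `sin α dθ dα` is the area element and `sin α sin θ` a Cartesian
coordinate `x` on a half-sphere, so Archimedes' theorem (area of the sphere projects uniformly onto
an axis) reduces the double integral to `2π ∫₀¹ f(x²) dx` (`integral_sin_mul_sin_sq`). Here that
theorem is proved for monomials from the Wallis integrals, then for continuous functions by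
Weierstrass approximation. What remains is
`2A ∫₀¹ (B² - A² + A² x²)^{-1/2} dx = 2 arsinh (A / √(B² - A²))`, and
`A / √(B² - A²) = sinh ((t - b) / 2)`.

*The weights in higher dimensions.* Iterating `(1/r) d/dr` takes `c r^{2k+1}` to
`(2k+1)‼ c r` (`invRadialDeriv_iterate_mul_pow`). The constants are normalised so that the result is
`r`, with derivative `1`: in odd dimension because the integral is the area of the sphere, in even
dimension because `2 ∫_{|y| ≤ 1} (1 - |y|²)^{-1/2} dy` is the area of the unit sphere one dimension
up (`two_mul_integral_closedBall`). Since `K` is even, both statements reduce to the integral above.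
-/

open Real

/-! ### The complete elliptic integral as a hypergeometric function -/

theorem ascPochhammer_half_eval (k : ℕ) :
    (k !⁻¹ : ℝ) * (ascPochhammer ℝ k).eval (1 / 2) =
      ∏ i ∈ Finset.range k, (2 * (i : ℝ) + 1) / (2 * i + 2) := by
  induction k with
  | zero => simp
  | succ k ih =>
    rw [Finset.prod_range_succ, ← ih, ascPochhammer_succ_eval, Nat.factorial_succ]
    push_cast
    have := Nat.factorial_ne_zero k
    field_simp
    ring

/-- The binomial series of `(1 - u)^{-1/2}`, with its coefficients in Wallis form. -/
theorem hasSum_one_sub_rpow_neg_half {u : ℝ} (hu : |u| < 1) :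
    HasSum (fun k : ℕ => (∏ i ∈ Finset.range k, (2 * (i : ℝ) + 1) / (2 * i + 2)) * u ^ k)
      ((1 - u) ^ (-(1 / 2) : ℝ)) := by
  have h := (Real.one_add_rpow_hasFPowerSeriesOnBall_zero (a := -(1 / 2))).hasSum
    (y := -u) (by simpa [enorm_eq_nnnorm, ← NNReal.coe_lt_coe] using hu)
  rw [binomialSeries_eq_ordinaryHypergeometricSeries (b := (1 : ℝ)) (by
    intro k hk; have : (0 : ℝ) ≤ k := k.cast_nonneg; linarith)] at h
  have h0 : 1 + (0 + -u) = 1 - u := by ring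
  rw [h0] at h
  refine (congrArg (fun g : ℕ → ℝ => HasSum g _) (funext fun k => ?_)).mpr h
  have h1 : (ascPochhammer ℝ k).eval 1 ≠ 0 := (ascPochhammer_pos k 1 one_pos).ne'
  have hv : (⇑(-ContinuousLinearMap.id ℝ ℝ) ∘ fun _ : Fin k => -u) = fun _ => u := by
    ext; simp
  rw [FormalMultilinearSeries.compContinuousLinearMap_apply, hv,
    ordinaryHypergeometricSeries_apply_eq, neg_neg, mul_inv_cancel_right₀ h1,
    ascPochhammer_half_eval, smul_eq_mul]

theorem integral_cos_pow_even (k : ℕ) :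
    ∫ θ in (0 : ℝ)..π, cos θ ^ (2 * k) =
      π * ∏ i ∈ Finset.range k, (2 * (i : ℝ) + 1) / (2 * i + 2) := by
  induction k with
  | zero => simp
  | succ k ih =>
    rw [mul_add_one, integral_cos_pow, ih, Finset.prod_range_succ]
    simp
    ring

/-- The complete elliptic integral of the first kind, from termwise integration of the binomial
series of `(1 - x cos² θ)^{-1/2}`: integrating `cos^{2k}` contributes a second copy of the
coefficient of that series. -/
theorem ordinaryHypergeometric_half_half_one {x : ℝ} (hx : |x| < 1) :
    ordinaryHypergeometric (1 / 2 : ℝ) (1 / 2 : ℝ) (1 : ℝ) x =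
      π⁻¹ * ∫ θ in (0 : ℝ)..π, (1 - x * cos θ ^ 2) ^ (-(1 / 2) : ℝ) := by
  set c : ℕ → ℝ := fun k => ∏ i ∈ Finset.range k, (2 * (i : ℝ) + 1) / (2 * i + 2) with hc
  have hc0 : ∀ k, 0 ≤ c k := fun k => Finset.prod_nonneg fun i _ => by positivity
  let f : ℕ → C(ℝ, ℝ) := fun k => ⟨fun θ => c k * (x * cos θ ^ 2) ^ k, by fun_prop⟩
  -- The terms are dominated by those of the series at `|x|`.
  have hf : Summable fun k =>
      ‖(f k).restrict (⟨Set.uIcc 0 π, isCompact_uIcc⟩ : TopologicalSpace.Compacts ℝ)‖ := by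
    have hs : Summable fun k => c k * |x| ^ k :=
      (hasSum_one_sub_rpow_neg_half (u := |x|) (by simpa using hx)).summable
    refine Summable.of_nonneg_of_le (fun _ => norm_nonneg _) (fun k => ?_) hs
    rw [ContinuousMap.norm_le _ (by have := hc0 k; positivity)]
    intro θ
    have : |x * cos θ ^ 2| ≤ |x| := by
      rw [abs_mul, abs_of_nonneg (sq_nonneg (cos θ.1))]
      exact mul_le_of_le_one_right (abs_nonneg x) (cos_sq_le_one _)
    simp only [f, ContinuousMap.restrict_apply, ContinuousMap.coe_mk]
    rw [norm_mul, norm_pow, Real.norm_eq_abs, Real.norm_eq_abs, abs_of_nonneg (hc0 k)]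
    have := hc0 k
    gcongr
  have h := intervalIntegral.hasSum_intervalIntegral_of_summable_norm hf
  have hint : ∀ k, ∫ θ in (0 : ℝ)..π, f k θ = π * (c k * c k * x ^ k) := by
    intro k
    have : ∀ θ, f k θ = c k * x ^ k * cos θ ^ (2 * k) := fun θ => by
      simp only [f, ContinuousMap.coe_mk, mul_pow, ← pow_mul]; ring
    simp only [this]
    rw [intervalIntegral.integral_const_mul, integral_cos_pow_even]
    ring
  have hsum : ∀ θ : ℝ, ∑' k, f k θ = (1 - x * cos θ ^ 2) ^ (-(1 / 2) : ℝ) := by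
    intro θ
    refine (hasSum_one_sub_rpow_neg_half ?_).tsum_eq
    rw [abs_mul, abs_of_nonneg (sq_nonneg (cos θ))]
    exact (mul_le_of_le_one_right (abs_nonneg x) (cos_sq_le_one _)).trans_lt hx
  simp only [hint, hsum] at h
  rw [← h.tsum_eq, tsum_mul_left, inv_mul_cancel_left₀ pi_ne_zero,
    ordinaryHypergeometric_eq_tsum]
  refine tsum_congr fun k => ?_
  rw [ascPochhammer_eval_one, smul_eq_mul]
  simp only [hc]
  rw [← ascPochhammer_half_eval]
  ring

/-! ### Archimedes' theorem on the sphere -/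

theorem continuous_integral_sin_mul_sin {f : ℝ → ℝ} (hf : Continuous f) :
    Continuous fun α : ℝ => sin α * ∫ θ in (0 : ℝ)..π, f ((sin α * sin θ) ^ 2) := by
  refine continuous_sin.mul ?_
  apply intervalIntegral.continuous_parametric_intervalIntegral_of_continuous'
  fun_prop

theorem integral_sin_mul_sin_sq_pow (k : ℕ) :
    ∫ α in (0 : ℝ)..π, sin α * ∫ θ in (0 : ℝ)..π, ((sin α * sin θ) ^ 2) ^ k =
      2 * π * ∫ x in (0 : ℝ)..1, (x ^ 2) ^ k := by
  have h : ∀ α : ℝ, sin α * ∫ θ in (0 : ℝ)..π, ((sin α * sin θ) ^ 2) ^ k =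
      (∫ θ in (0 : ℝ)..π, sin θ ^ (2 * k)) * sin α ^ (2 * k + 1) := fun α => by
    simp only [mul_pow, ← pow_mul, intervalIntegral.integral_const_mul]
    ring
  simp only [h]
  simp only [intervalIntegral.integral_const_mul, integral_sin_pow_even, integral_sin_pow_odd,
    ← pow_mul, integral_pow]
  have hp : (∏ i ∈ Finset.range k, (2 * (i : ℝ) + 1) / (2 * i + 2)) *
      ∏ i ∈ Finset.range k, (2 * (i : ℝ) + 2) / (2 * i + 3) = 1 / (2 * k + 1) := by
    induction k with
    | zero => simp
    | succ k ih =>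
      rw [Finset.prod_range_succ, Finset.prod_range_succ, mul_mul_mul_comm, ih (by
        intro α
        simp only [mul_pow, ← pow_mul, intervalIntegral.integral_const_mul]
        ring)]
      push_cast
      field_simp
      ring
  rw [mul_assoc, mul_left_comm _ (2 : ℝ), hp]
  simp
  ring

theorem integral_sin_mul_sin_sq_polynomial (p : Polynomial ℝ) :
    ∫ α in (0 : ℝ)..π, sin α * ∫ θ in (0 : ℝ)..π, p.eval ((sin α * sin θ) ^ 2) =
      2 * π * ∫ x in (0 : ℝ)..1, p.eval (x ^ 2) := by
  induction p using Polynomial.induction_on' with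
  | add p q hp hq =>
    simp only [Polynomial.eval_add]
    rw [intervalIntegral.integral_add (Continuous.intervalIntegrable (by fun_prop) _ _)
      (Continuous.intervalIntegrable (by fun_prop) _ _), mul_add, ← hp, ← hq,
      ← intervalIntegral.integral_add
        ((continuous_integral_sin_mul_sin p.continuous).intervalIntegrable _ _)
        ((continuous_integral_sin_mul_sin q.continuous).intervalIntegrable _ _)]
    congr 1
    ext α
    rw [intervalIntegral.integral_add (Continuous.intervalIntegrable (by fun_prop) _ _)
      (Continuous.intervalIntegrable (by fun_prop) _ _), mul_add]
  | monomial k a =>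
    simp only [Polynomial.eval_monomial, intervalIntegral.integral_const_mul]
    simp only [mul_left_comm _ a, intervalIntegral.integral_const_mul, integral_sin_mul_sin_sq_pow]

/-- Archimedes' theorem: on the half-sphere with colatitude `α` and longitude `θ` in `[0, π]`, the
coordinate `sin α sin θ` is distributed uniformly on `[0, 1]` with respect to the area
`sin α dθ dα`. Only even functions of that coordinate are considered. -/
theorem integral_sin_mul_sin_sq {f : ℝ → ℝ} (hf : Continuous f) :
    ∫ α in (0 : ℝ)..π, sin α * ∫ θ in (0 : ℝ)..π, f ((sin α * sin θ) ^ 2) =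
      2 * π * ∫ x in (0 : ℝ)..1, f (x ^ 2) := by
  rw [← sub_eq_zero, ← abs_nonpos_iff]
  refine le_of_forall_pos_le_add fun ε hε => ?_
  -- Replacing `f` by a `δ`-close polynomial changes the left side by at most `π * π * δ` and the
  -- right side by at most `2 * π * δ`.
  obtain ⟨δ, hδ, hδε⟩ : ∃ δ > 0, (π * π + 2 * π) * δ = ε :=
    ⟨ε / (π * π + 2 * π), by positivity, by field_simp⟩
  obtain ⟨p, hp⟩ := exists_polynomial_near_of_continuousOn 0 1 f hf.continuousOn δ hδ
  have hL : |(∫ α in (0 : ℝ)..π, sin α * ∫ θ in (0 : ℝ)..π, p.eval ((sin α * sin θ) ^ 2)) -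
      ∫ α in (0 : ℝ)..π, sin α * ∫ θ in (0 : ℝ)..π, f ((sin α * sin θ) ^ 2)| ≤ π * π * δ := by
    rw [← intervalIntegral.integral_sub
        ((continuous_integral_sin_mul_sin p.continuous).intervalIntegrable _ _)
        ((continuous_integral_sin_mul_sin hf).intervalIntegrable _ _), ← Real.norm_eq_abs]
    refine (intervalIntegral.norm_integral_le_of_norm_le_const (C := δ * π)
      fun α _ => ?_).trans_eq ?_
    · rw [← mul_sub, ← intervalIntegral.integral_sub
        (Continuous.intervalIntegrable (by fun_prop) _ _)
        (Continuous.intervalIntegrable (by fun_prop) _ _), norm_mul]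
      refine (mul_le_of_le_one_left (norm_nonneg _) (abs_sin_le_one α)).trans ?_
      refine (intervalIntegral.norm_integral_le_of_norm_le_const (C := δ)
        fun θ _ => ?_).trans_eq ?_
      · refine (hp _ ⟨sq_nonneg _, ?_⟩).le
        rw [mul_pow]
        exact mul_le_one₀ (sin_sq_le_one _) (sq_nonneg _) (sin_sq_le_one _)
      · rw [sub_zero, abs_of_pos pi_pos]
    · rw [sub_zero, abs_of_pos pi_pos]; ring
  have hR : |(∫ x in (0 : ℝ)..1, p.eval (x ^ 2)) - ∫ x in (0 : ℝ)..1, f (x ^ 2)| ≤ δ := by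
    rw [← intervalIntegral.integral_sub (Continuous.intervalIntegrable (by fun_prop) _ _)
        (Continuous.intervalIntegrable (by fun_prop) _ _), ← Real.norm_eq_abs]
    refine (intervalIntegral.norm_integral_le_of_norm_le_const (C := δ)
      fun x hx => ?_).trans_eq (by simp)
    refine (hp _ ⟨sq_nonneg _, ?_⟩).le
    rw [Set.uIoc_of_le zero_le_one] at hx
    exact pow_le_one₀ hx.1.le hx.2
  rw [integral_sin_mul_sin_sq_polynomial] at hL
  rw [abs_le] at hL hR ⊢
  have := pi_pos
  constructor <;> nlinarith [hL.1, hL.2, hR.1, hR.2]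

/-! ### The integral of the kernel -/

theorem two_mul_integral_rpow_neg_half {t b : ℝ} :
    2 * ∫ x in (0 : ℝ)..1, (exp (-b) - exp (-t)) *
      ((exp (-b) + exp (-t)) ^ 2 - (exp (-b) - exp (-t)) ^ 2 +
        (exp (-b) - exp (-t)) ^ 2 * x ^ 2) ^ (-(1 / 2) : ℝ) = t - b := by
  have hD : (exp (-b) + exp (-t)) ^ 2 - (exp (-b) - exp (-t)) ^ 2 =
      (2 * exp (-(b + t) / 2)) ^ 2 := by
    have : exp (-(b + t) / 2) ^ 2 = exp (-b) * exp (-t) := by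
      rw [← exp_nat_mul, ← exp_add]; push_cast; ring_nf
    rw [mul_pow, this]; ring
  have hA : exp (-b) - exp (-t) = sinh ((t - b) / 2) * (2 * exp (-(b + t) / 2)) := by
    rw [sinh_eq]
    have h1 : exp ((t - b) / 2) * exp (-(b + t) / 2) = exp (-b) := by rw [← exp_add]; ring_nf
    have h2 : exp (-((t - b) / 2)) * exp (-(b + t) / 2) = exp (-t) := by rw [← exp_add]; ring_nf
    linear_combination -h1 + h2
  rw [hD, hA]
  have hE : 0 < 2 * exp (-(b + t) / 2) := by positivity
  generalize 2 * exp (-(b + t) / 2) = E at hE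
  set S := sinh ((t - b) / 2) with hS
  have hint : ∀ x : ℝ, S * E * (E ^ 2 + (S * E) ^ 2 * x ^ 2) ^ (-(1 / 2) : ℝ) =
      (√(1 + (S * x) ^ 2))⁻¹ * S := by
    intro x
    rw [show E ^ 2 + (S * E) ^ 2 * x ^ 2 = E ^ 2 * (1 + (S * x) ^ 2) by ring,
      rpow_neg (by positivity), ← sqrt_eq_rpow, sqrt_mul (sq_nonneg E), sqrt_sq hE.le]
    field_simp
  have hder : ∀ x : ℝ, HasDerivAt (fun x => arsinh (S * x)) ((√(1 + (S * x) ^ 2))⁻¹ * S) x := by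
    intro x
    simpa using! (hasDerivAt_arsinh (S * x)).comp x ((hasDerivAt_id x).const_mul S)
  have hcont : Continuous fun x : ℝ => (√(1 + (S * x) ^ 2))⁻¹ * S := by
    refine Continuous.mul (Continuous.inv₀ (by fun_prop) fun x => ?_) continuous_const
    positivity
  simp only [hint]
  rw [intervalIntegral.integral_eq_sub_of_hasDerivAt (fun x _ => hder x)
    (hcont.intervalIntegrable _ _)]
  simp [hS, arsinh_sinh]
  ring

/-- The factor `(B² - z²)^{-1/2}` cancels the denominator in the argument of the elliptic
integral; at `z = -A cos α` what is left depends on the angles only through `sin α sin θ`. -/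
theorem deSitterKernel_neg_mul_cos {t b : ℝ} (hbt : b ≤ t) (α : ℝ) :
    deSitterKernel t b (-((exp (-b) - exp (-t)) * cos α)) =
      π⁻¹ * ∫ θ in (0 : ℝ)..π, ((exp (-b) + exp (-t)) ^ 2 - (exp (-b) - exp (-t)) ^ 2 +
        (exp (-b) - exp (-t)) ^ 2 * (sin α * sin θ) ^ 2) ^ (-(1 / 2) : ℝ) := by
  have hA : 0 ≤ exp (-b) - exp (-t) := sub_nonneg.2 (exp_le_exp.2 (neg_le_neg hbt))
  have hAB : exp (-b) - exp (-t) < exp (-b) + exp (-t) := by linarith [exp_pos (-t)]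
  rw [deSitterKernel, add_comm (exp (-t))]
  generalize exp (-b) - exp (-t) = A at *
  generalize exp (-b) + exp (-t) = B at *
  rw [neg_sq, mul_pow]
  have hAB2 : A ^ 2 < B ^ 2 := pow_lt_pow_left₀ hAB hA two_ne_zero
  have hz : A ^ 2 * cos α ^ 2 ≤ A ^ 2 := mul_le_of_le_one_right (sq_nonneg A) (cos_sq_le_one _)
  have hM : 0 < B ^ 2 - A ^ 2 * cos α ^ 2 := by linarith
  have hx0 : 0 ≤ (A ^ 2 - A ^ 2 * cos α ^ 2) / (B ^ 2 - A ^ 2 * cos α ^ 2) :=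
    div_nonneg (by linarith) hM.le
  have hx1 : (A ^ 2 - A ^ 2 * cos α ^ 2) / (B ^ 2 - A ^ 2 * cos α ^ 2) < 1 := by
    rw [div_lt_one hM]; linarith
  rw [ordinaryHypergeometric_half_half_one (by rwa [abs_of_nonneg hx0]), mul_left_comm,
    ← intervalIntegral.integral_const_mul]
  congr 2
  ext θ
  rw [← mul_rpow hM.le (sub_nonneg.2 (mul_le_one₀ hx1.le (sq_nonneg _) (cos_sq_le_one _)))]
  congr 1
  rw [mul_sub, ← mul_assoc, mul_div_cancel₀ _ hM.ne', mul_pow, sin_sq, sin_sq]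
  ring

theorem integral_deSitterKernel {t b : ℝ} (hbt : b ≤ t) :
    ∫ z in (-(exp (-b) - exp (-t)))..(exp (-b) - exp (-t)), deSitterKernel t b z = t - b := by
  set A := exp (-b) - exp (-t) with hA
  set D := (exp (-b) + exp (-t)) ^ 2 - A ^ 2 with hD
  have hA0 : 0 ≤ A := sub_nonneg.2 (exp_le_exp.2 (neg_le_neg hbt))
  have hD0 : 0 < D := by
    have := exp_pos (-b); have := exp_pos (-t)
    rw [hD, hA, show ∀ x y : ℝ, (x + y) ^ 2 - (x - y) ^ 2 = 4 * (x * y) by intros; ring]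
    positivity
  -- The substitution `z = -(A * cos α)` is monotone, so the kernel need not be known continuous.
  have hcov := intervalIntegral.integral_comp_mul_deriv_of_deriv_nonneg (a := 0) (b := π)
    (f := fun α => -(A * cos α)) (f' := fun α => A * sin α) (g := deSitterKernel t b)
    (by fun_prop)
    (fun α _ => by simpa using! ((hasDerivAt_cos α).const_mul A).neg)
    (fun α hα => by
      rw [min_eq_left pi_pos.le, max_eq_right pi_pos.le] at hα
      exact mul_nonneg hA0 (sin_pos_of_mem_Ioo hα).le)
  simp only [cos_zero, cos_pi, mul_one, mul_neg, neg_neg, Function.comp_apply] at hcov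
  rw [← hcov]
  -- The absolute value makes the function continuous on all of `ℝ`; its arguments are squares.
  have hf : Continuous fun u : ℝ => (D + A ^ 2 * |u|) ^ (-(1 / 2) : ℝ) := by
    refine Continuous.rpow_const (by fun_prop) fun u => Or.inl ?_
    positivity
  have harch := integral_sin_mul_sin_sq hf
  simp only [abs_pow, sq_abs] at harch
  have hker : ∀ α, deSitterKernel t b (-(A * cos α)) * (A * sin α) = A * π⁻¹ *
      (sin α * ∫ θ in (0 : ℝ)..π, (D + A ^ 2 * (sin α * sin θ) ^ 2) ^ (-(1 / 2) : ℝ)) := by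
    intro α
    rw [deSitterKernel_neg_mul_cos hbt]
    ring
  simp only [hker, intervalIntegral.integral_const_mul, harch]
  rw [← two_mul_integral_rpow_neg_half (t := t) (b := b), intervalIntegral.integral_const_mul]
  simp only [← hA, ← hD]
  field_simp

/-- No integrability is needed: if `f` is not integrable on `[0, a]`, both sides are the default
value `0`. -/
theorem two_mul_integral_of_even {f : ℝ → ℝ} (hf : ∀ x, f (-x) = f x) (a : ℝ) :
    2 * ∫ x in (0 : ℝ)..a, f x = ∫ x in (-a)..a, f x := by
  have hneg : ∫ x in (-a)..0, f x = ∫ x in (0 : ℝ)..a, f x := by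
    simpa [hf] using (intervalIntegral.integral_comp_neg (a := 0) (b := a) f).symm
  by_cases hi : IntervalIntegrable f volume 0 a
  · have hi' : IntervalIntegrable f volume (-a) 0 := by
      simpa [hf] using ((IntervalIntegrable.iff_comp_neg (f := f)).1 hi).symm
    rw [← intervalIntegral.integral_add_adjacent_intervals hi' hi, hneg, two_mul]
  · rw [intervalIntegral.integral_undef hi, intervalIntegral.integral_undef, mul_zero]
    intro h
    refine hi (h.mono_set ?_)
    intro x hx
    rw [Set.mem_uIcc] at *
    rcases hx with hx | hx
    · exact Or.inl ⟨by linarith, hx.2⟩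
    · exact Or.inr ⟨hx.1, by linarith⟩

/-! ### The weights in higher dimensions -/

/-- The identity holds at `r = 0` too: there `1 / r = 0`, and only odd powers of `r` occur. -/
theorem invRadialDeriv_iterate_mul_pow (c : ℝ) (k : ℕ) :
    (invRadialDeriv^[k] fun r => c * r ^ (2 * k + 1)) = fun r => c * (2 * k + 1 : ℕ)‼ * r := by
  induction k generalizing c with
  | zero => simp
  | succ k ih =>
    have h : (invRadialDeriv fun r => c * r ^ (2 * (k + 1) + 1)) =
        fun r => c * (2 * k + 3 : ℕ) * r ^ (2 * k + 1) := by
      ext r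
      rw [invRadialDeriv, deriv_const_mul_field, deriv_pow_field]
      rcases eq_or_ne r 0 with rfl | hr
      · simp
      · simp only [mul_add_one, Nat.add_sub_cancel]
        push_cast
        field_simp
        ring
    rw [Function.iterate_succ_apply, h, ih, show 2 * (k + 1) + 1 = 2 * k + 1 + 2 by ring,
      Nat.doubleFactorial_add_two]
    push_cast
    ext r
    ring

theorem integral_pow_div_sqrt_one_sub_sq (k : ℕ) :
    ∫ r in (0 : ℝ)..1, r ^ (2 * k + 1) * (1 / √(1 - r ^ 2)) =
      ∏ i ∈ Finset.range k, (2 * (i : ℝ) + 2) / (2 * i + 3) := by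
  have hpi : (0 : ℝ) ≤ π / 2 := by positivity
  have hcov := intervalIntegral.integral_comp_mul_deriv_of_deriv_nonpos (a := 0) (b := π / 2)
    (f := cos) (f' := fun α => -sin α) (g := fun r => r ^ (2 * k + 1) * (1 / √(1 - r ^ 2)))
    (by fun_prop) (fun α _ => hasDerivAt_cos α)
    (fun α hα => by
      rw [min_eq_left hpi, max_eq_right hpi] at hα
      exact neg_nonpos.2 (sin_pos_of_pos_of_lt_pi hα.1 (by linarith [hα.2, pi_pos])).le)
  rw [cos_zero, cos_pi_div_two, intervalIntegral.integral_symm 0 1] at hcov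
  rw [← neg_eq_iff_eq_neg.2 hcov]
  -- The integrand is unbounded only at `r = 1`, that is `α = 0`, which `Ι 0 (π / 2)` omits.
  have h : ∫ α in (0 : ℝ)..(π / 2),
      ((fun r : ℝ => r ^ (2 * k + 1) * (1 / √(1 - r ^ 2))) ∘ cos) α * -sin α =
      ∫ α in (0 : ℝ)..(π / 2), -cos α ^ (2 * k + 1) := by
    refine intervalIntegral.integral_congr_ae (.of_forall fun α hα => ?_)
    rw [Set.uIoc_of_le hpi] at hα
    have hs : 0 < sin α := sin_pos_of_pos_of_lt_pi hα.1 (by linarith [hα.2, pi_pos])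
    simp only [Function.comp_apply]
    rw [← sin_sq, sqrt_sq hs.le]
    field_simp
  rw [h, intervalIntegral.integral_neg, EulerSine.integral_cos_pow_eq, integral_sin_pow_odd]
  ring

theorem prod_range_mul_doubleFactorial (k : ℕ) :
    (∏ i ∈ Finset.range k, (2 * (i : ℝ) + 2) / (2 * i + 3)) * (2 * k + 1 : ℕ)‼ = 2 ^ k * k ! := by
  induction k with
  | zero => simp
  | succ k ih =>
    rw [Finset.prod_range_succ, show 2 * (k + 1) + 1 = 2 * k + 1 + 2 by ring,
      Nat.doubleFactorial_add_two, Nat.factorial_succ]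
    push_cast
    have h3 : (2 * (k : ℝ) + 3) ≠ 0 := by positivity
    rw [pow_succ]
    linear_combination (norm := skip) (2 * (k : ℝ) + 2) * ih
    field_simp
    ring

theorem sphereArea_pos (d : ℕ) : 0 < sphereArea d := by
  rw [sphereArea, surfaceMeasure, Measure.toSphere_real_apply_univ]
  have : 0 < volume.real (Metric.ball (0 : EuclideanSpace ℝ (Fin (d + 1))) 1) :=
    ENNReal.toReal_pos (Metric.measure_ball_pos _ _ one_pos).ne' measure_ball_lt_top.ne
  simp only [finrank_euclideanSpace, Fintype.card_fin]
  positivity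

/-- The unit sphere of `ℝ^{n+1}` is the union of two graphs over the unit ball of `ℝ^n`, with area
element `(1 - |y|²)^{-1/2} dy`. The proof for even `n` compares values: polar coordinates on the left,
the volumes of the unit balls of `ℝ^n` and `ℝ^{n+1}`. -/
theorem two_mul_integral_closedBall (k : ℕ) :
    2 * ∫ y in Metric.closedBall (0 : EuclideanSpace ℝ (Fin (2 * (k + 1)))) 1,
        1 / √(1 - ‖y‖ ^ 2) = sphereArea (2 * (k + 1)) := by
  have h1 : ∫ y in Metric.closedBall (0 : EuclideanSpace ℝ (Fin (2 * (k + 1)))) 1,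
      1 / √(1 - ‖y‖ ^ 2) = (2 * (k + 1) : ℕ) * (π ^ (k + 1) / (k + 1)!) *
        ∏ i ∈ Finset.range k, (2 * (i : ℝ) + 2) / (2 * i + 3) := by
    have hind : ∀ y : EuclideanSpace ℝ (Fin (2 * (k + 1))),
        (Metric.closedBall (0 : EuclideanSpace ℝ (Fin (2 * (k + 1)))) 1).indicator
          (fun y => 1 / √(1 - ‖y‖ ^ 2)) y =
        (Set.Iic (1 : ℝ)).indicator (fun r => 1 / √(1 - r ^ 2)) ‖y‖ := by
      intro y
      by_cases hy : ‖y‖ ≤ 1 <;> simp [Set.indicator, hy]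
    rw [← integral_indicator Metric.isClosed_closedBall.measurableSet]
    simp only [hind]
    rw [integral_fun_norm_addHaar volume
      ((Set.Iic (1 : ℝ)).indicator fun r => 1 / √(1 - r ^ 2)),
      Measure.real, InnerProductSpace.volume_ball_of_dim_even (k := k + 1) (by simp),
      finrank_euclideanSpace, Fintype.card_fin, ← integral_pow_div_sqrt_one_sub_sq,
      intervalIntegral.integral_of_le zero_le_one, ← Set.Ioi_inter_Iic,
      ← setIntegral_indicator (measurableSet_Iic (a := (1 : ℝ)))]
    have hp : (0 : ℝ) ≤ π ^ (k + 1) / (k + 1)! := by positivity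
    simp only [ENNReal.ofReal_one, one_pow, one_mul, ENNReal.toReal_ofReal hp, smul_eq_mul,
      nsmul_eq_mul, mul_assoc]
    congr 3
    ext r
    simp only [Set.indicator, show 2 * (k + 1) - 1 = 2 * k + 1 by omega]
    split_ifs <;> simp
  have hp : (0 : ℝ) ≤ π ^ (k + 1) * 2 ^ (k + 1 + 1) / (2 * (k + 1) + 1 : ℕ)‼ := by positivity
  rw [h1, sphereArea, surfaceMeasure, Measure.toSphere_real_apply_univ, Measure.real,
    InnerProductSpace.volume_ball_of_dim_odd (k := k + 1) (by simp)]
  simp only [finrank_euclideanSpace, Fintype.card_fin, ENNReal.ofReal_one, one_pow, one_mul,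
    ENNReal.toReal_ofReal hp]
  have hprod := prod_range_mul_doubleFactorial k
  have hdf : ((2 * k + 1 : ℕ)‼ : ℝ) ≠ 0 := by exact_mod_cast (Nat.doubleFactorial_pos _).ne'
  rw [← eq_div_iff hdf] at hprod
  rw [hprod, show 2 * (k + 1) + 1 = 2 * k + 1 + 2 by ring, Nat.doubleFactorial_add_two,
    Nat.factorial_succ]
  have hf := Nat.factorial_ne_zero k
  push_cast
  field_simp
  ring

theorem deSitterKernel_neg (t b z : ℝ) : deSitterKernel t b (-z) = deSitterKernel t b z := by
  simp [deSitterKernel]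

theorem corollary2p2 (t b : ℝ) (hb : 0 ≤ b) (hbt : b ≤ t) :
    -- (i) dimension one
    (t - b = ∫ z in (-(Real.exp (-b) - Real.exp (-t)))..(Real.exp (-b) - Real.exp (-t)),
        deSitterKernel t b z) ∧
    -- (ii) odd dimensions at least three
    (∀ n m : ℕ, 1 ≤ m → n = 2 * m + 1 →
      t - b = 2 * ∫ r₁ in (0 : ℝ)..(Real.exp (-b) - Real.exp (-t)),
        deriv (invRadialDeriv^[(n - 3) / 2] fun r : ℝ =>
            r ^ (n - 2) / (sphereArea (n - 1) * ((n - 2)‼ : ℝ)) *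
              ∫ _y : Metric.sphere (0 : EuclideanSpace ℝ (Fin n)) 1, (1 : ℝ) ∂(surfaceMeasure n))
          r₁ * deSitterKernel t b r₁) ∧
    -- (iii) even dimensions at least two
    (∀ n m : ℕ, 1 ≤ m → n = 2 * m →
      t - b = 2 * ∫ r₁ in (0 : ℝ)..(Real.exp (-b) - Real.exp (-t)),
        deriv (invRadialDeriv^[(n - 2) / 2] fun r : ℝ =>
            2 * r ^ (n - 1) / (sphereArea n * ((n - 1)‼ : ℝ)) *
              ∫ y in Metric.closedBall (0 : EuclideanSpace ℝ (Fin n)) 1,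
                1 / Real.sqrt (1 - ‖y‖ ^ 2))
          r₁ * deSitterKernel t b r₁) := by
  have h2 : t - b = 2 * ∫ r in (0 : ℝ)..(exp (-b) - exp (-t)), deSitterKernel t b r := by
    rw [two_mul_integral_of_even (deSitterKernel_neg t b), integral_deSitterKernel hbt]
  have hder : ∀ k r, deriv (invRadialDeriv^[k] fun r : ℝ =>
      (1 / ((2 * k + 1 : ℕ)‼ : ℝ)) * r ^ (2 * k + 1)) r = 1 := by
    intro k r
    have hdf : ((2 * k + 1 : ℕ)‼ : ℝ) ≠ 0 := by exact_mod_cast (Nat.doubleFactorial_pos _).ne'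
    rw [invRadialDeriv_iterate_mul_pow, one_div, inv_mul_cancel₀ hdf]
    simp
  refine ⟨(integral_deSitterKernel hbt).symm, ?_, ?_⟩
  · rintro n m hm rfl
    obtain ⟨k, rfl⟩ := Nat.exists_eq_add_of_le' hm
    have harea : ∫ _y : Metric.sphere (0 : EuclideanSpace ℝ (Fin (2 * (k + 1) + 1))) 1,
        (1 : ℝ) ∂(surfaceMeasure (2 * (k + 1) + 1)) = sphereArea (2 * (k + 1)) := by
      simp [sphereArea]
    have hω := (sphereArea_pos (2 * (k + 1))).ne'
    have hfun : (fun r : ℝ => r ^ (2 * (k + 1) + 1 - 2) /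
        (sphereArea (2 * (k + 1) + 1 - 1) * ((2 * (k + 1) + 1 - 2)‼ : ℝ)) *
          ∫ _y : Metric.sphere (0 : EuclideanSpace ℝ (Fin (2 * (k + 1) + 1))) 1,
            (1 : ℝ) ∂(surfaceMeasure (2 * (k + 1) + 1))) =
        fun r => (1 / ((2 * k + 1 : ℕ)‼ : ℝ)) * r ^ (2 * k + 1) := by
      ext r
      rw [harea, show 2 * (k + 1) + 1 - 2 = 2 * k + 1 by omega, Nat.add_sub_cancel]
      field_simp
    rw [hfun, show (2 * (k + 1) + 1 - 3) / 2 = k by omega]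
    simpa only [hder, one_mul] using h2
  · rintro n m hm rfl
    obtain ⟨k, rfl⟩ := Nat.exists_eq_add_of_le' hm
    have hω := (sphereArea_pos (2 * (k + 1))).ne'
    have hfun : (fun r : ℝ => 2 * r ^ (2 * (k + 1) - 1) /
        (sphereArea (2 * (k + 1)) * ((2 * (k + 1) - 1)‼ : ℝ)) *
          ∫ y in Metric.closedBall (0 : EuclideanSpace ℝ (Fin (2 * (k + 1)))) 1,
            1 / Real.sqrt (1 - ‖y‖ ^ 2)) =
        fun r => (1 / ((2 * k + 1 : ℕ)‼ : ℝ)) * r ^ (2 * k + 1) := by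
      ext r
      rw [show 2 * (k + 1) - 1 = 2 * k + 1 by omega, mul_div_assoc, mul_assoc, mul_left_comm,
        two_mul_integral_closedBall]
      field_simp
    rw [hfun, show (2 * (k + 1) - 2) / 2 = k by omega]
    simpa only [hder, one_mul] using h2
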